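/- Let $n\ge 1$ be an integer and let $U_1,U_1',\dots,U_n,U_n'$ be $2n$ independent random variables, each uniformly distributed on $[0,1)$, regarded as points on a circle of circumference $1$ and almost surely all distinct; let $U_{1:2n}<U_{2:2n}<\dots<U_{2n:2n}$ be their order statistics. Run the Bernoulli clock: start at $0$, move clockwise (in the increasing direction, modulo $1$) to the first point encountered among $U_1,U_1'$, continue clockwise from there to the first point encountered among $U_2,U_2'$, and so on, until the first point encountered among $U_n,U_n'$ is reached. Let $I_n\in\{1,\dots,2n\}$ be the random index such that the point at which the clock stops is $U_{I_n:2n}$. Then $$\mathbb P(I_n=k)=\frac1{2n}-\delta_{k:2n}\qquad\text{for all integers }1\le k\le 2n,$$ where $$\delta_{k:2n}=\frac{2^{n-1}}{n\cdot n!}\sum_{i=0}^{n}\frac{\binom{k-1}{i}\binom{n}{i}}{\binom{2n-1}{i}}\,B_{n-i},$$ and $B_m=B_m(0)$ is the $m$-th Bernoulli number (so $B_1=-\tfrac12$). Moreover, there is a polynomial with rational coefficients, of degree at most $n$, whose value at $k$ is $\delta_{k:2n}$ for every $1\le k\le 2n$. -/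

import Mathlib

open MeasureTheory ProbabilityTheory

noncomputable section

namespace BernoulliClock

/-- The clockwise distance from `x` to `y` on the circle `ℝ / ℤ`, represented by `[0, 1)`. -/
def arc (x y : ℝ) : ℝ := Int.fract (y - x)

/-- Whichever of the two points `a`, `b` is encountered first
when moving clockwise around the circle from `x`. -/
def firstOf (x a b : ℝ) : ℝ := if arc x a ≤ arc x b then a else b

/-- The position on the circle after `k` steps of the Bernoulli clock with the `n` pairs of points
`u (i, 0)`, `u (i, 1)`: start at `0`, move clockwise to the first point of the first pair,
from there clockwise to the first point of the second pair, and so on. -/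
def position {n : ℕ} (u : Fin n × Fin 2 → ℝ) : (k : ℕ) → k ≤ n → ℝ
  | 0, _ => 0
  | k + 1, h => firstOf (position u k (Nat.le_of_succ_le h)) (u (⟨k, h⟩, 0)) (u (⟨k, h⟩, 1))

/-- The index `j` of `x` among the order statistics `u_{1:2n} < u_{2:2n} < ... < u_{2n:2n}` of the
`2n` points `u p`, that is, the `j` with `x = u_{j:2n}`, for `x` one of the points
and the points all distinct: the number of the points that are at most `x`. -/
def orderIndex {n : ℕ} (u : Fin n × Fin 2 → ℝ) (x : ℝ) : ℕ :=
  (Finset.univ.filter fun p => u p ≤ x).card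

/-- The index `I_n` of the point at which the Bernoulli clock stops after its `n` steps. -/
def clockIndex {n : ℕ} (u : Fin n × Fin 2 → ℝ) : ℕ := orderIndex u (position u n le_rfl)

/-- `δ_{k:2n}`. Mathlib's `bernoulli m` is `B_m(0)`, with `bernoulli 1 = -1/2`. -/
def delta (n k : ℕ) : ℚ :=
  2 ^ (n - 1) / (n * n.factorial) *
    ∑ i ∈ Finset.range (n + 1),
      ((k - 1).choose i : ℚ) * (n.choose i : ℚ) / ((2 * n - 1).choose i : ℚ) * bernoulli (n - i)

end BernoulliClock

end

/-! The law of the stopping position is computed in two ways.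

Analytically: from `x`, the first of two uniform points has density `2 * (1 - arc x y)` in `y`.
Starting from `2 * (1 - y)`, each further step applies this kernel, and integration by parts shows
that it carries `1 - 2^k/k! B_k` to `1 - 2^(k+1)/(k+1)! B_{k+1}` (`integral_arc_mul_clockDensity`,
`integral_position`). So the distribution function of the position is a primitive of an explicit
polynomial.

Combinatorially: the index depends only on the relative order of the points, hence is independent of
every symmetric event, such as "exactly `j` points are at most `x`", which is binomial. The position
is at most `x` exactly when the index is at most that number (`clockIndex_le_iff`), so the same
distribution function is a Bernstein sum with coefficients `P(I_n ≤ j)`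
(`exists_measureReal_clockIndex_le`).

The proposed values of `P(I_n ≤ j)` give the same polynomial (`sum_bernstein_delta`), and Bernstein
polynomials are linearly independent, so the coefficients agree. -/

noncomputable section

namespace BernoulliClock

/-! ### Arcs on the circle and the law of one step -/

/-- Lebesgue measure on `[0, 1)`. -/
abbrev unifMeasure : Measure ℝ := volume.restrict (Set.Ico 0 1)

instance : IsProbabilityMeasure unifMeasure := ⟨by simp⟩

lemma integral_unifMeasure (g : ℝ → ℝ) : ∫ y, g y ∂unifMeasure = ∫ y in (0 : ℝ)..1, g y := by
  rw [intervalIntegral.integral_of_le zero_le_one, integral_Ico_eq_integral_Ioc]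

lemma measurable_arc : Measurable fun z : ℝ × ℝ => arc z.1 z.2 :=
  measurable_fract.comp (measurable_snd.sub measurable_fst)

lemma measurable_arc_right (x : ℝ) : Measurable (arc x) :=
  measurable_arc.comp measurable_prodMk_left

lemma arc_nonneg (x y : ℝ) : 0 ≤ arc x y := Int.fract_nonneg _

lemma arc_lt_one (x y : ℝ) : arc x y < 1 := Int.fract_lt_one _

/-- Rotation invariance: `h ∘ Int.fract` has period 1, so its integral over every unit interval is
the same. -/
lemma integral_comp_arc (x : ℝ) (h : ℝ → ℝ) :
    ∫ b, h (arc x b) ∂unifMeasure = ∫ b, h b ∂unifMeasure := by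
  have hper : Function.Periodic (fun b : ℝ => h (Int.fract b)) 1 := fun b => by simp
  calc ∫ b, h (arc x b) ∂unifMeasure = ∫ b in (0 : ℝ)..1, h (Int.fract (b - x)) :=
        integral_unifMeasure _
    _ = ∫ b in (0 - x)..(1 - x), h (Int.fract b) :=
        intervalIntegral.integral_comp_sub_right (fun b => h (Int.fract b)) x
    _ = ∫ b in (0 : ℝ)..1, h (Int.fract b) := by
        have := hper.intervalIntegral_add_eq (0 - x) 0
        rwa [show 0 - x + 1 = 1 - x by ring, zero_add] at this
    _ = ∫ b, h b ∂unifMeasure := by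
        rw [← integral_unifMeasure]
        refine setIntegral_congr_fun measurableSet_Ico fun b hb => ?_
        simp only [Int.fract_eq_self.2 hb]

lemma unifMeasure_real_arc_mem (x : ℝ) {s : Set ℝ} (hs : MeasurableSet s) :
    unifMeasure.real {b | arc x b ∈ s} = unifMeasure.real s := by
  have h := integral_comp_arc x (s.indicator 1)
  rw [integral_indicator_one hs] at h
  rw [← h]
  exact (integral_indicator_one (measurable_arc_right x hs)).symm

lemma unifMeasure_real_le_arc (x : ℝ) {t : ℝ} (h0 : 0 ≤ t) (h1 : t < 1) :
    unifMeasure.real {b | t ≤ arc x b} = 1 - t := by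
  refine (unifMeasure_real_arc_mem x (measurableSet_Ici (a := t))).trans ?_
  rw [measureReal_restrict_apply measurableSet_Ici]
  have : Set.Ici t ∩ Set.Ico 0 1 = Set.Ico t 1 := by
    ext y; simp only [Set.mem_inter_iff, Set.mem_Ici, Set.mem_Ico]
    exact ⟨fun h => ⟨h.1, h.2.2⟩, fun h => ⟨h.1, h0.trans h.1, h.2⟩⟩
  rw [this, Real.volume_real_Ico_of_le h1.le]

lemma unifMeasure_real_lt_arc (x : ℝ) {t : ℝ} (h0 : 0 ≤ t) (h1 : t < 1) :
    unifMeasure.real {b | t < arc x b} = 1 - t := by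
  refine (unifMeasure_real_arc_mem x (measurableSet_Ioi (a := t))).trans ?_
  rw [measureReal_restrict_apply measurableSet_Ioi]
  have : Set.Ioi t ∩ Set.Ico 0 1 = Set.Ioo t 1 := by
    ext y; simp only [Set.mem_inter_iff, Set.mem_Ioi, Set.mem_Ico, Set.mem_Ioo]
    exact ⟨fun h => ⟨h.1, h.2.2⟩, fun h => ⟨h.1, h0.trans h.1.le, h.2⟩⟩
  rw [this, Real.volume_real_Ioo_of_le h1.le]

lemma measurable_firstOf : Measurable fun z : ℝ × ℝ × ℝ => firstOf z.1 z.2.1 z.2.2 := by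
  refine Measurable.ite (measurableSet_le ?_ ?_) (by fun_prop) (by fun_prop)
  · exact measurable_arc.comp (by fun_prop : Measurable fun z : ℝ × ℝ × ℝ => (z.1, z.2.1))
  · exact measurable_arc.comp (by fun_prop : Measurable fun z : ℝ × ℝ × ℝ => (z.1, z.2.2))

/-- Either point may be the one met first; given that it sits at `y`, the other lies farther along
with probability `1 - arc x y`. The two cases contribute equally, whence the factor 2. -/
lemma integral_firstOf (x : ℝ) {g : ℝ → ℝ} (hg : Measurable g) {C : ℝ} (hC : ∀ y, |g y| ≤ C) :
    ∫ z, g (firstOf x z.1 z.2) ∂(unifMeasure.prod unifMeasure)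
      = ∫ y, 2 * (1 - arc x y) * g y ∂unifMeasure := by
  have harc := measurable_arc_right x
  have m1 : MeasurableSet {z : ℝ × ℝ | arc x z.1 ≤ arc x z.2} :=
    measurableSet_le (harc.comp measurable_fst) (harc.comp measurable_snd)
  have m2 : MeasurableSet {z : ℝ × ℝ | arc x z.2 < arc x z.1} :=
    measurableSet_lt (harc.comp measurable_snd) (harc.comp measurable_fst)
  have i1 : Integrable ({z : ℝ × ℝ | arc x z.1 ≤ arc x z.2}.indicator fun z => g z.1)
      (unifMeasure.prod unifMeasure) :=
    (Integrable.of_bound (hg.comp measurable_fst).aestronglyMeasurable C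
      (.of_forall fun z => hC _)).indicator m1
  have i2 : Integrable ({z : ℝ × ℝ | arc x z.2 < arc x z.1}.indicator fun z => g z.2)
      (unifMeasure.prod unifMeasure) :=
    (Integrable.of_bound (hg.comp measurable_snd).aestronglyMeasurable C
      (.of_forall fun z => hC _)).indicator m2
  have hsplit : (fun z : ℝ × ℝ => g (firstOf x z.1 z.2)) = fun z =>
      {z : ℝ × ℝ | arc x z.1 ≤ arc x z.2}.indicator (fun z => g z.1) z
      + {z : ℝ × ℝ | arc x z.2 < arc x z.1}.indicator (fun z => g z.2) z := by
    funext z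
    by_cases h : arc x z.1 ≤ arc x z.2
    · simp [firstOf, h]
    · simp [firstOf, h, not_le.1 h]
  have e1 : ∀ a, ∫ b, {z : ℝ × ℝ | arc x z.1 ≤ arc x z.2}.indicator (fun z => g z.1) (a, b)
      ∂unifMeasure = (1 - arc x a) * g a := fun a => by
    rw [← unifMeasure_real_le_arc x (arc_nonneg x a) (arc_lt_one x a), ← smul_eq_mul,
      ← integral_indicator_const _ (measurableSet_le measurable_const harc)]
    rfl
  have e2 : ∀ b, ∫ a, {z : ℝ × ℝ | arc x z.2 < arc x z.1}.indicator (fun z => g z.2) (a, b)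
      ∂unifMeasure = (1 - arc x b) * g b := fun b => by
    rw [← unifMeasure_real_lt_arc x (arc_nonneg x b) (arc_lt_one x b), ← smul_eq_mul,
      ← integral_indicator_const _ (measurableSet_lt measurable_const harc)]
    rfl
  rw [hsplit, integral_add i1 i2, integral_prod _ i1, integral_prod_symm _ i2]
  simp_rw [e1, e2, mul_assoc, integral_const_mul]
  ring

/-! ### Bernoulli polynomials as densities of the clock -/

/-- The density of the position of the Bernoulli clock after `k ≥ 1` steps. -/
def clockDensity (k : ℕ) (y : ℝ) : ℝ := 1 - 2 ^ k / k.factorial * bernoulliFun k y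

lemma continuous_bernoulliFun (k : ℕ) : Continuous (bernoulliFun k) :=
  continuous_iff_continuousAt.2 fun x => (hasDerivAt_bernoulliFun k x).continuousAt

lemma continuous_clockDensity (k : ℕ) : Continuous (clockDensity k) :=
  continuous_const.sub (continuous_const.mul (continuous_bernoulliFun k))

lemma clockDensity_one (y : ℝ) : clockDensity 1 y = 2 * (1 - y) := by
  simp [clockDensity, bernoulliFun_one]; ring

lemma integral_clockDensity (k : ℕ) (a b : ℝ) :
    ∫ y in a..b, clockDensity k y = b - a
      - 2 ^ k / k.factorial * ((bernoulliFun (k + 1) b - bernoulliFun (k + 1) a) / (k + 1)) := by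
  have h : ∫ y in a..b, bernoulliFun k y
      = bernoulliFun (k + 1) b / (k + 1) - bernoulliFun (k + 1) a / (k + 1) :=
    intervalIntegral.integral_eq_sub_of_hasDerivAt (fun x _ => antideriv_bernoulliFun k x)
      ((continuous_bernoulliFun k).intervalIntegrable _ _)
  have hc := continuous_bernoulliFun k
  unfold clockDensity
  rw [intervalIntegral.integral_sub (by simp)
    ((by fun_prop : Continuous _).intervalIntegrable _ _),
    intervalIntegral.integral_const_mul, h, intervalIntegral.integral_const, smul_eq_mul]
  ring

lemma bernoulliFun_one_eq_zero {k : ℕ} (hk : 2 ≤ k) : bernoulliFun k 1 = bernoulliFun k 0 := by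
  rw [bernoulliFun_eval_one, if_neg (by omega), add_zero]

lemma integral_clockDensity_unit {k : ℕ} (hk : 1 ≤ k) :
    ∫ y in (0 : ℝ)..1, clockDensity k y = 1 := by
  rw [integral_clockDensity, bernoulliFun_one_eq_zero (by omega)]; simp

lemma integral_id_mul_clockDensity {k : ℕ} (hk : 1 ≤ k) :
    ∫ y in (0 : ℝ)..1, y * clockDensity k y
      = 1 / 2 - 2 ^ k / k.factorial * (bernoulliFun (k + 1) 1 / (k + 1)) := by
  have hB : ∫ y in (0 : ℝ)..1, y * bernoulliFun k y = bernoulliFun (k + 1) 1 / (k + 1) := by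
    rw [intervalIntegral.integral_mul_deriv_eq_deriv_mul (fun x _ => hasDerivAt_id' x)
      (fun x _ => antideriv_bernoulliFun k x) (by simp)
      ((continuous_bernoulliFun k).intervalIntegrable _ _)]
    simp only [one_mul, zero_mul, sub_zero]
    rw [intervalIntegral.integral_div, integral_bernoulliFun_eq_zero (by omega)]
    simp
  have : (fun y => y * clockDensity k y)
      = fun y => y - 2 ^ k / k.factorial * (y * bernoulliFun k y) := by
    funext y; simp only [clockDensity]; ring
  have hc := continuous_bernoulliFun k
  rw [this, intervalIntegral.integral_sub (by simp)
    ((by fun_prop : Continuous _).intervalIntegrable _ _),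
    intervalIntegral.integral_const_mul, hB]
  simp

lemma arc_of_le {x y : ℝ} (hx : 0 ≤ x) (hy : y < 1) (h : x ≤ y) : arc x y = y - x :=
  Int.fract_eq_self.2 ⟨by linarith, by linarith⟩

lemma arc_of_lt {x y : ℝ} (hx : x < 1) (hy : 0 ≤ y) (h : y < x) : arc x y = y - x + 1 := by
  rw [arc, ← Int.fract_add_one]
  exact Int.fract_eq_self.2 ⟨by linarith, by linarith⟩

/-- One step of the clock transforms the `k`-th density into the next one. -/
lemma integral_arc_mul_clockDensity {k : ℕ} (hk : 1 ≤ k) {y : ℝ} (hy : y ∈ Set.Ico (0 : ℝ) 1) :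
    ∫ x, 2 * (1 - arc x y) * clockDensity k x ∂unifMeasure = clockDensity (k + 1) y := by
  have hc := continuous_clockDensity k
  have hlin : Continuous fun x => 2 * (1 - y) * clockDensity k x + 2 * (x * clockDensity k x) := by
    fun_prop
  have hmeas : Measurable fun x => arc x y := measurable_arc.comp measurable_prodMk_right
  -- The arc is `y - x` for `x ≤ y` and gains 1 when it passes the origin; the indicator term is
  -- that correction.
  have hfun : Set.EqOn (fun x => 2 * (1 - arc x y) * clockDensity k x)
      (fun x => (2 * (1 - y) * clockDensity k x + 2 * (x * clockDensity k x))
        - (Set.Ioi y).indicator (fun x => 2 * clockDensity k x) x) (Set.Ico 0 1) := by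
    intro x hx
    rcases le_or_gt x y with h | h
    · simp only [arc_of_le hx.1 hy.2 h, Set.indicator_of_notMem (show x ∉ Set.Ioi y from not_lt.2 h)]
      ring
    · simp only [arc_of_lt hx.2 hy.1 h, Set.indicator_of_mem (show x ∈ Set.Ioi y from h)]
      ring
  have hint : ∀ {f : ℝ → ℝ}, Continuous f → Integrable f unifMeasure := fun hf =>
    (hf.integrableOn_Icc (a := (0 : ℝ)) (b := 1)).mono_set Set.Ico_subset_Icc_self
  have hind : ∫ x, (Set.Ioi y).indicator (fun x => 2 * clockDensity k x) x ∂unifMeasure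
      = 2 * ∫ x in y..1, clockDensity k x := by
    rw [integral_indicator measurableSet_Ioi, Measure.restrict_restrict measurableSet_Ioi,
      show Set.Ioi y ∩ Set.Ico 0 1 = Set.Ioo y 1 by
        ext z; simp only [Set.mem_inter_iff, Set.mem_Ioi, Set.mem_Ico, Set.mem_Ioo]
        exact ⟨fun h => ⟨h.1, h.2.2⟩, fun h => ⟨h.1, hy.1.trans h.1.le, h.2⟩⟩,
      ← integral_Ioc_eq_integral_Ioo, ← intervalIntegral.integral_of_le hy.2.le,
      intervalIntegral.integral_const_mul]
  -- The values of `bernoulliFun (k + 1)` at 1 from the first moment and from the tail integral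
  -- cancel, leaving only its value at `y`.
  rw [setIntegral_congr_fun measurableSet_Ico hfun,
    integral_sub (hint hlin) ((hint (by fun_prop)).indicator measurableSet_Ioi), hind,
    integral_unifMeasure, intervalIntegral.integral_add
      ((by fun_prop : Continuous _).intervalIntegrable _ _)
      ((by fun_prop : Continuous _).intervalIntegrable _ _),
    intervalIntegral.integral_const_mul, intervalIntegral.integral_const_mul,
    integral_clockDensity_unit hk, integral_id_mul_clockDensity hk, integral_clockDensity,
    clockDensity, Nat.factorial_succ]
  have hk1 : (k : ℝ) + 1 ≠ 0 := by positivity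
  have hkf : (k.factorial : ℝ) ≠ 0 := by positivity
  push_cast
  field_simp
  ring

/-- Fubini moves the one-step average from the test function to the density. -/
lemma integral_step_mul_clockDensity {k : ℕ} (hk : 1 ≤ k) {g : ℝ → ℝ} (hg : Measurable g)
    {C : ℝ} (hC : ∀ y, |g y| ≤ C) :
    ∫ x, (∫ y, 2 * (1 - arc x y) * g y ∂unifMeasure) * clockDensity k x ∂unifMeasure
      = ∫ y, g y * clockDensity (k + 1) y ∂unifMeasure := by
  obtain ⟨D, hD⟩ := isCompact_Icc.exists_bound_of_continuousOn
    (continuous_clockDensity k).continuousOn (s := Set.Icc (0 : ℝ) 1)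
  have hint : Integrable (Function.uncurry fun x y =>
      2 * (1 - arc x y) * g y * clockDensity k x) (unifMeasure.prod unifMeasure) := by
    refine Integrable.of_bound (C := 2 * C * D) ?_ ?_
    · exact (((measurable_const.mul (measurable_const.sub measurable_arc)).mul
        (hg.comp measurable_snd)).mul
        ((continuous_clockDensity k).measurable.comp measurable_fst)).aestronglyMeasurable
    -- The bound `D` on the density is known only on the unit interval, so domination is almost
    -- everywhere.
    · have h1 : ∀ᵐ x ∂unifMeasure, x ∈ Set.Ico (0 : ℝ) 1 := ae_restrict_mem measurableSet_Ico
      filter_upwards [Measure.quasiMeasurePreserving_fst.ae h1] with z hz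
      have h2 : |2 * (1 - arc z.1 z.2)| ≤ 2 := by
        rw [abs_le]
        constructor <;> linarith [arc_nonneg z.1 z.2, arc_lt_one z.1 z.2]
      have h3 := hD z.1 (Set.Ico_subset_Icc_self hz)
      have h4 := hC z.2
      simp only [Function.uncurry_def, Real.norm_eq_abs, abs_mul (_ * g _), abs_mul _ (g _)] at h3 ⊢
      gcongr
      exact mul_nonneg zero_le_two ((abs_nonneg _).trans h4)
  simp_rw [← integral_mul_const]
  rw [integral_integral_swap hint]
  refine setIntegral_congr_fun measurableSet_Ico fun y hy => ?_
  rw [← integral_arc_mul_clockDensity hk hy, ← integral_const_mul]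
  congr 1
  funext x
  ring

/-! ### The law of the position after each step -/

section Position

variable {n : ℕ}

lemma position_congr {u v : Fin n × Fin 2 → ℝ} : ∀ (k : ℕ) (h : k ≤ n),
    (∀ p : Fin n × Fin 2, p.1.val < k → u p = v p) → position u k h = position v k h
  | 0, _, _ => rfl
  | k + 1, h, huv => by
    simp only [position]
    rw [position_congr k (Nat.le_of_succ_le h) fun p hp => huv p (hp.trans k.lt_succ_self),
      huv (⟨k, h⟩, 0) k.lt_succ_self, huv (⟨k, h⟩, 1) k.lt_succ_self]

lemma measurable_position : ∀ (k : ℕ) (h : k ≤ n),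
    Measurable fun u : Fin n × Fin 2 → ℝ => position u k h
  | 0, _ => measurable_const
  | k + 1, h => by
    have h0 : Measurable fun u : Fin n × Fin 2 → ℝ => u (⟨k, h⟩, 0) := measurable_pi_apply _
    have h1 : Measurable fun u : Fin n × Fin 2 → ℝ => u (⟨k, h⟩, 1) := measurable_pi_apply _
    exact measurable_firstOf.comp
      ((measurable_position k (Nat.le_of_succ_le h)).prodMk (h0.prodMk h1))

lemma measurable_step {g : ℝ → ℝ} (hg : Measurable g) :
    Measurable fun x => ∫ y, 2 * (1 - arc x y) * g y ∂unifMeasure := by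
  have : Measurable fun z : ℝ × ℝ => 2 * (1 - arc z.1 z.2) * g z.2 :=
    (measurable_const.mul (measurable_const.sub measurable_arc)).mul (hg.comp measurable_snd)
  exact this.stronglyMeasurable.integral_prod_right'.measurable

lemma map_eq_unifMeasure {Ω : Type*} [MeasurableSpace Ω] {μ : Measure Ω} {X : Ω → ℝ}
    (h : pdf.IsUniform X (Set.Ico (0 : ℝ) 1) μ volume) : μ.map X = unifMeasure := by
  rw [h, ProbabilityTheory.cond]; simp

variable {Ω : Type*} [MeasurableSpace Ω] {μ : Measure Ω} {U : Fin n × Fin 2 → Ω → ℝ}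

lemma indepFun_position (hmeas : ∀ p, Measurable (U p)) (hindep : iIndepFun U μ) (k : ℕ)
    (h : k < n) :
    IndepFun (fun ω => position (fun p => U p ω) k h.le)
      (fun ω => (U (⟨k, h⟩, 0) ω, U (⟨k, h⟩, 1) ω)) μ := by
  classical
  let S : Finset (Fin n × Fin 2) := Finset.univ.filter fun p => p.1.val < k
  let T : Finset (Fin n × Fin 2) := Finset.univ.filter fun p => p.1.val = k
  have hST : Disjoint S T := Finset.disjoint_filter.2 fun p _ hp hp' => hp.ne hp'
  have hT : ∀ j : Fin 2, ((⟨k, h⟩, j) : Fin n × Fin 2) ∈ T := fun j => by simp [T]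
  -- The default 0 outside `S` is harmless: the first `k` steps see only the first `k` pairs.
  let φ : (S → ℝ) → ℝ := fun v => position (fun p => if hp : p ∈ S then v ⟨p, hp⟩ else 0) k h.le
  let ψ : (T → ℝ) → ℝ × ℝ := fun v => (v ⟨(⟨k, h⟩, 0), hT 0⟩, v ⟨(⟨k, h⟩, 1), hT 1⟩)
  have hφ : Measurable φ := by
    refine (measurable_position k h.le).comp (measurable_pi_lambda _ fun p => ?_)
    by_cases hp : p ∈ S
    · simpa only [hp, dite_true] using measurable_pi_apply _
    · simp only [hp, dite_false, measurable_const]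
  have hψ : Measurable ψ := (measurable_pi_apply _).prodMk (measurable_pi_apply _)
  have key := (hindep.indepFun_finset S T hST hmeas).comp hφ hψ
  convert key using 1
  swap
  · rfl
  funext ω
  refine position_congr k h.le fun p hp => ?_
  have : p ∈ S := by simpa [S] using hp
  simp [this]

variable [IsProbabilityMeasure μ]

lemma integral_position_succ (hmeas : ∀ p, Measurable (U p))
    (hunif : ∀ p, pdf.IsUniform (U p) (Set.Ico (0 : ℝ) 1) μ volume)
    (hindep : iIndepFun U μ) {g : ℝ → ℝ} (hg : Measurable g) {C : ℝ} (hC : ∀ y, |g y| ≤ C)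
    (k : ℕ) (h : k < n) :
    ∫ ω, g (position (fun p => U p ω) (k + 1) h) ∂μ
      = ∫ ω, ∫ y, 2 * (1 - arc (position (fun p => U p ω) k h.le) y) * g y ∂unifMeasure ∂μ := by
  set X : Ω → ℝ := fun ω => position (fun p => U p ω) k h.le with hX
  have hXm : Measurable X := (measurable_position k h.le).comp (measurable_pi_lambda _ hmeas)
  set V : Ω → ℝ × ℝ := fun ω => (U (⟨k, h⟩, 0) ω, U (⟨k, h⟩, 1) ω) with hV
  have hVm : Measurable V := (hmeas _).prodMk (hmeas _)
  have hmapV : μ.map V = unifMeasure.prod unifMeasure := by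
    have hi : IndepFun (U (⟨k, h⟩, 0)) (U (⟨k, h⟩, 1)) μ := hindep.indepFun (by simp)
    rw [(indepFun_iff_map_prod_eq_prod_map_map (hmeas _).aemeasurable (hmeas _).aemeasurable).1 hi,
      map_eq_unifMeasure (hunif _), map_eq_unifMeasure (hunif _)]
  have hmap : μ.map (fun ω => (X ω, V ω)) = (μ.map X).prod (unifMeasure.prod unifMeasure) := by
    rw [(indepFun_iff_map_prod_eq_prod_map_map hXm.aemeasurable hVm.aemeasurable).1
      (indepFun_position hmeas hindep k h), hmapV]
  have : IsProbabilityMeasure (μ.map X) := Measure.isProbabilityMeasure_map hXm.aemeasurable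
  have hgf : Measurable fun z : ℝ × ℝ × ℝ => g (firstOf z.1 z.2.1 z.2.2) :=
    hg.comp measurable_firstOf
  calc ∫ ω, g (position (fun p => U p ω) (k + 1) h) ∂μ
      = ∫ z, g (firstOf z.1 z.2.1 z.2.2) ∂(μ.map fun ω => (X ω, V ω)) :=
        (integral_map (hXm.prodMk hVm).aemeasurable hgf.aestronglyMeasurable).symm
    _ = ∫ x, ∫ y, 2 * (1 - arc x y) * g y ∂unifMeasure ∂(μ.map X) := by
        rw [hmap, integral_prod _ (Integrable.of_bound hgf.aestronglyMeasurable C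
          (.of_forall fun z => hC _))]
        simp_rw [integral_firstOf _ hg hC]
    _ = _ := by
        exact integral_map hXm.aemeasurable (measurable_step hg).aestronglyMeasurable

/-- Induction over all bounded test functions at once, since a step replaces `g` by its one-step
average. It begins at step 1 because the initial law is a point mass. -/
theorem integral_position (hmeas : ∀ p, Measurable (U p))
    (hunif : ∀ p, pdf.IsUniform (U p) (Set.Ico (0 : ℝ) 1) μ volume)
    (hindep : iIndepFun U μ) {g : ℝ → ℝ} (hg : Measurable g) {C : ℝ} (hC : ∀ y, |g y| ≤ C)
    (k : ℕ) (h : k < n) :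
    ∫ ω, g (position (fun p => U p ω) (k + 1) h) ∂μ
      = ∫ y, g y * clockDensity (k + 1) y ∂unifMeasure := by
  induction k generalizing g C with
  | zero =>
    rw [integral_position_succ hmeas hunif hindep hg hC]
    simp only [position, integral_const, probReal_univ, one_smul]
    refine setIntegral_congr_fun measurableSet_Ico fun y hy => ?_
    simp only [arc_of_le le_rfl hy.2 hy.1, sub_zero, clockDensity_one, zero_add]
    ring
  | succ k ih =>
    rw [integral_position_succ hmeas hunif hindep hg hC]
    have hbound : ∀ x, |∫ y, 2 * (1 - arc x y) * g y ∂unifMeasure| ≤ 2 * C := fun x => by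
      have := norm_integral_le_of_norm_le_const (μ := unifMeasure) (C := 2 * C)
        (f := fun y => 2 * (1 - arc x y) * g y) (.of_forall fun y => by
          have h2 : |2 * (1 - arc x y)| ≤ 2 := by
            rw [abs_le]
            constructor <;> linarith [arc_nonneg x y, arc_lt_one x y]
          have h4 := hC y
          rw [Real.norm_eq_abs, abs_mul]
          gcongr)
      simpa using this
    rw [ih (measurable_step hg) hbound (Nat.lt_of_succ_lt h),
      integral_step_mul_clockDensity (Nat.succ_le_succ k.zero_le) hg hC]

theorem measureReal_position_le (hn : 1 ≤ n) (hmeas : ∀ p, Measurable (U p))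
    (hunif : ∀ p, pdf.IsUniform (U p) (Set.Ico (0 : ℝ) 1) μ volume)
    (hindep : iIndepFun U μ) {x : ℝ} (h0 : 0 ≤ x) (h1 : x < 1) :
    μ.real {ω | position (fun p => U p ω) n le_rfl ≤ x}
      = x - 2 ^ n / n.factorial * ((bernoulliFun (n + 1) x - bernoulliFun (n + 1) 0) / (n + 1)) := by
  obtain ⟨k, rfl⟩ : ∃ k, n = k + 1 := ⟨n - 1, by omega⟩
  have hX : Measurable fun ω => position (fun p => U p ω) (k + 1) le_rfl :=
    (measurable_position (k + 1) le_rfl).comp (measurable_pi_lambda _ hmeas)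
  have key := integral_position hmeas hunif hindep (g := (Set.Iic x).indicator 1)
    (measurable_one.indicator measurableSet_Iic) (C := 1)
    (fun y => by by_cases hy : y ∈ Set.Iic x <;> simp [hy]) k k.lt_succ_self
  have hl : ∫ ω, (Set.Iic x).indicator (1 : ℝ → ℝ)
      (position (fun p => U p ω) (k + 1) k.lt_succ_self) ∂μ
      = μ.real {ω | position (fun p => U p ω) (k + 1) le_rfl ≤ x} :=
    integral_indicator_one (hX measurableSet_Iic)
  rw [← hl, key]
  have : (fun y => (Set.Iic x).indicator (1 : ℝ → ℝ) y * clockDensity (k + 1) y)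
      = (Set.Iic x).indicator (clockDensity (k + 1)) := by
    funext y; by_cases hy : y ∈ Set.Iic x <;> simp [hy]
  rw [this, integral_indicator measurableSet_Iic, Measure.restrict_restrict measurableSet_Iic,
    show Set.Iic x ∩ Set.Ico 0 1 = Set.Icc 0 x by
      ext z; simp only [Set.mem_inter_iff, Set.mem_Iic, Set.mem_Ico, Set.mem_Icc]
      exact ⟨fun h => ⟨h.2.1, h.1⟩, fun h => ⟨h.2, h.1, h.2.trans_lt h1⟩⟩,
    integral_Icc_eq_integral_Ioc, ← intervalIntegral.integral_of_le h0, integral_clockDensity,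
    sub_zero]

end Position

/-! ### Order-invariant conditions -/

section Order

variable {ι : Type*}

/-- Two families of reals whose members are ordered in the same way. -/
def SameOrder (u v : ι → ℝ) : Prop := ∀ p q, u p ≤ u q ↔ v p ≤ v q

/-- The right side uses only linear comparisons among `x`, `a`, `b`, so the choice made by the clock
is order-invariant. -/
lemma arc_le_arc_iff {x a b : ℝ} (hx : x ∈ Set.Ico (0 : ℝ) 1) (ha : a ∈ Set.Ico (0 : ℝ) 1)
    (hb : b ∈ Set.Ico (0 : ℝ) 1) :
    arc x a ≤ arc x b ↔ (x ≤ a ∧ (x ≤ b → a ≤ b)) ∨ (¬ x ≤ a ∧ ¬ x ≤ b ∧ a ≤ b) := by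
  obtain ⟨hx0, hx1⟩ := hx
  obtain ⟨ha0, ha1⟩ := ha
  obtain ⟨hb0, hb1⟩ := hb
  rcases le_or_gt x a with h | h <;> rcases le_or_gt x b with h' | h'
  · rw [arc_of_le hx0 ha1 h, arc_of_le hx0 hb1 h']; simp [h, h']
  · rw [arc_of_le hx0 ha1 h, arc_of_lt hx1 hb0 h']; simp [h, h'.not_ge]; linarith
  · rw [arc_of_lt hx1 ha0 h, arc_of_le hx0 hb1 h']; simp [h.not_ge, h']; linarith
  · rw [arc_of_lt hx1 ha0 h, arc_of_lt hx1 hb0 h']; simp [h.not_ge, h'.not_ge]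

lemma exists_perm_sameOrder [Fintype ι] {u v : ι → ℝ} (hu : u.Injective) (hv : v.Injective) :
    ∃ τ : Equiv.Perm ι, SameOrder (u ∘ τ) v := by
  let e := Fintype.equivFin ι
  have key : ∀ w : ι → ℝ, w.Injective →
      ∃ a : Fin (Fintype.card ι) ≃ ι, StrictMono (w ∘ a) := fun w hw =>
    ⟨(Tuple.sort (w ∘ e.symm)).trans e.symm,
      (Tuple.monotone_sort (w ∘ e.symm)).strictMono_of_injective
        ((hw.comp e.symm.injective).comp (Tuple.sort (w ∘ e.symm)).injective)⟩
  obtain ⟨a, ha⟩ := key u hu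
  obtain ⟨b, hb⟩ := key v hv
  refine ⟨b.symm.trans a, fun p q => ?_⟩
  have h1 := ha.le_iff_le (a := b.symm p) (b := b.symm q)
  have h2 := hb.le_iff_le (a := b.symm p) (b := b.symm q)
  simp only [Function.comp_apply, Equiv.apply_symm_apply] at h1 h2
  simp only [Function.comp_apply, Equiv.trans_apply, h1, h2]

lemma SameOrder.comp_perm {u v : ι → ℝ} (h : SameOrder u v) (σ : Equiv.Perm ι) :
    SameOrder (u ∘ σ) (v ∘ σ) := fun p q => h (σ p) (σ q)

open Classical in
/-- The number of arrangements of a family of distinct points of `[0, 1)` that satisfy an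
order-invariant condition does not depend on the family. -/
lemma exists_card_perm_eq [Fintype ι] {A : Set (ι → ℝ)}
    (hA : ∀ u v : ι → ℝ, (∀ p, u p ∈ Set.Ico (0 : ℝ) 1) → (∀ p, v p ∈ Set.Ico (0 : ℝ) 1) →
      SameOrder u v → (u ∈ A ↔ v ∈ A)) :
    ∃ N : ℕ, ∀ u : ι → ℝ, u.Injective → (∀ p, u p ∈ Set.Ico (0 : ℝ) 1) →
      (Finset.univ.filter fun σ : Equiv.Perm ι => u ∘ σ ∈ A).card = N := by
  by_cases hex : ∃ v : ι → ℝ, v.Injective ∧ ∀ p, v p ∈ Set.Ico (0 : ℝ) 1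
  · obtain ⟨v, hv, hv'⟩ := hex
    refine ⟨(Finset.univ.filter fun σ : Equiv.Perm ι => v ∘ σ ∈ A).card, fun u hu hu' => ?_⟩
    obtain ⟨τ, hτ⟩ := exists_perm_sameOrder hu hv
    symm
    -- As `u ∘ τ` is ordered like `v`, the arrangement `σ` of `v` corresponds to the arrangement `τ
    -- * σ` of `u`.
    refine Finset.card_equiv (Equiv.mulLeft τ) fun σ => ?_
    simp only [Finset.mem_filter, Finset.mem_univ, true_and, Equiv.coe_mulLeft, Equiv.Perm.coe_mul]
    exact (hA _ _ (fun p => hu' _) (fun p => hv' _) (hτ.comp_perm σ)).symm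
  · exact ⟨0, fun u hu hu' => (hex ⟨u, hu, hu'⟩).elim⟩

end Order

/-! ### Exchangeability of independent uniform points -/

section Exchangeable

lemma ae_mem_Ico {ι : Type*} [Countable ι] {Ω : Type*} [MeasurableSpace Ω] {μ : Measure Ω}
    {U : ι → Ω → ℝ} (hmeas : ∀ p, Measurable (U p))
    (hunif : ∀ p, pdf.IsUniform (U p) (Set.Ico (0 : ℝ) 1) μ volume) :
    ∀ᵐ ω ∂μ, ∀ p, U p ω ∈ Set.Ico (0 : ℝ) 1 := by
  refine ae_all_iff.2 fun p => ?_
  have h : ∀ᵐ x ∂(μ.map (U p)), x ∈ Set.Ico (0 : ℝ) 1 := by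
    rw [map_eq_unifMeasure (hunif p)]; exact ae_restrict_mem measurableSet_Ico
  exact ae_of_ae_map (hmeas p).aemeasurable h
variable {ι : Type*} [Fintype ι] {Ω : Type*} [MeasurableSpace Ω] {μ : Measure Ω}
  [IsProbabilityMeasure μ] {U : ι → Ω → ℝ}

lemma map_eq_pi (hmeas : ∀ p, Measurable (U p))
    (hunif : ∀ p, pdf.IsUniform (U p) (Set.Ico (0 : ℝ) 1) μ volume) (hindep : iIndepFun U μ) :
    μ.map (fun ω p => U p ω) = Measure.pi fun _ => unifMeasure := by
  rw [(iIndepFun_iff_map_fun_eq_pi_map fun p => (hmeas p).aemeasurable).1 hindep]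
  simp_rw [map_eq_unifMeasure (hunif _)]

lemma measureReal_comp_perm (hmeas : ∀ p, Measurable (U p))
    (hunif : ∀ p, pdf.IsUniform (U p) (Set.Ico (0 : ℝ) 1) μ volume) (hindep : iIndepFun U μ)
    (σ : Equiv.Perm ι) {A : Set (ι → ℝ)} (hA : MeasurableSet A) :
    μ.real {ω | (fun p => U p ω) ∘ σ ∈ A} = μ.real {ω | (fun p => U p ω) ∈ A} := by
  have h1 := map_eq_pi (U := fun p => U (σ p)) (fun p => hmeas _) (fun p => hunif _)
    (hindep.precomp σ.injective)
  rw [← map_eq_pi hmeas hunif hindep] at h1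
  have h2 := map_measureReal_apply (μ := μ) (measurable_pi_lambda _ hmeas) hA
  have h3 := map_measureReal_apply (μ := μ) (measurable_pi_lambda _ fun p => hmeas (σ p)) hA
  rw [h1] at h3
  exact h3.symm.trans h2

lemma ae_injective (hmeas : ∀ p, Measurable (U p))
    (hunif : ∀ p, pdf.IsUniform (U p) (Set.Ico (0 : ℝ) 1) μ volume) (hindep : iIndepFun U μ) :
    ∀ᵐ ω ∂μ, Function.Injective fun p => U p ω := by
  have h : ∀ p q, p ≠ q → ∀ᵐ ω ∂μ, U p ω ≠ U q ω := fun p q hpq => by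
    have hm := (indepFun_iff_map_prod_eq_prod_map_map (hmeas p).aemeasurable
      (hmeas q).aemeasurable).1 (hindep.indepFun hpq)
    rw [map_eq_unifMeasure (hunif _), map_eq_unifMeasure (hunif _)] at hm
    have hd : MeasurableSet {z : ℝ × ℝ | z.1 = z.2} :=
      measurableSet_eq_fun measurable_fst measurable_snd
    have h0 : (unifMeasure.prod unifMeasure) {z : ℝ × ℝ | z.1 = z.2} = 0 := by
      rw [Measure.measure_prod_null hd]
      refine .of_forall fun x => ?_
      have : Prod.mk x ⁻¹' {z : ℝ × ℝ | z.1 = z.2} = {x} := by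
        ext y; simp [eq_comm]
      simp [this]
    rw [← hm, Measure.map_apply ((hmeas p).prodMk (hmeas q)) hd] at h0
    exact measure_eq_zero_iff_ae_notMem.1 h0
  have h' : ∀ᵐ ω ∂μ, ∀ p q, p ≠ q → U p ω ≠ U q ω :=
    ae_all_iff.2 fun p => ae_all_iff.2 fun q => by
      by_cases hpq : p = q
      · exact .of_forall fun ω h => (h hpq).elim
      · filter_upwards [h p q hpq] with ω hω _ using hω
  filter_upwards [h'] with ω hω p q hpq
  by_contra hne
  exact hω p q hne hpq

/-- For independent uniform points, order-invariant events are independent of symmetric ones. -/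
lemma exists_measureReal_inter_eq {A : Set (ι → ℝ)} (hAm : MeasurableSet A)
    (hA : ∀ u v : ι → ℝ, (∀ p, u p ∈ Set.Ico (0 : ℝ) 1) → (∀ p, v p ∈ Set.Ico (0 : ℝ) 1) →
      SameOrder u v → (u ∈ A ↔ v ∈ A)) (hmeas : ∀ p, Measurable (U p))
    (hunif : ∀ p, pdf.IsUniform (U p) (Set.Ico (0 : ℝ) 1) μ volume) (hindep : iIndepFun U μ) :
    ∃ r : ℚ, ∀ B : Set (ι → ℝ), MeasurableSet B →
      (∀ (σ : Equiv.Perm ι) (u : ι → ℝ), u ∘ σ ∈ B ↔ u ∈ B) →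
      μ.real {ω | (fun p => U p ω) ∈ A ∩ B} = r * μ.real {ω | (fun p => U p ω) ∈ B} := by
  classical
  obtain ⟨N, hN⟩ := exists_card_perm_eq hA
  -- The proportion of favourable arrangements. The probabilities of `A ∩ B` are summed over all
  -- rearrangements: by exchangeability they are all equal, while almost surely exactly `N`
  -- rearrangements lie in `A`.
  refine ⟨N / (Fintype.card ι).factorial, fun B hB hBσ => ?_⟩
  have hUm : Measurable fun ω p => U p ω := measurable_pi_lambda _ hmeas
  have hUσ : ∀ σ : Equiv.Perm ι, Measurable fun ω => (fun p => U p ω) ∘ σ := fun σ =>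
    measurable_pi_lambda _ fun p => hmeas (σ p)
  have hset : ∀ σ : Equiv.Perm ι, MeasurableSet {ω | (fun p => U p ω) ∘ σ ∈ A ∩ B} := fun σ =>
    hUσ σ (hAm.inter hB)
  have h1 : ∑ σ : Equiv.Perm ι, μ.real {ω | (fun p => U p ω) ∘ σ ∈ A ∩ B}
      = (Fintype.card ι).factorial * μ.real {ω | (fun p => U p ω) ∈ A ∩ B} := by
    rw [Finset.sum_congr rfl fun σ _ =>
      measureReal_comp_perm hmeas hunif hindep σ (hAm.inter hB), Finset.sum_const,
      Finset.card_univ, Fintype.card_perm, nsmul_eq_mul]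
  have h2 : ∑ σ : Equiv.Perm ι, μ.real {ω | (fun p => U p ω) ∘ σ ∈ A ∩ B}
      = N * μ.real {ω | (fun p => U p ω) ∈ B} := by
    rw [Finset.sum_congr rfl fun σ _ => (integral_indicator_one (μ := μ) (hset σ)).symm]
    change ∑ σ : Equiv.Perm ι, ∫ ω, {ω | (fun p => U p ω) ∘ σ ∈ A ∩ B}.indicator
      (fun _ => (1 : ℝ)) ω ∂μ = _
    rw [← integral_finsetSum _ fun σ _ =>
      (integrable_const (1 : ℝ)).indicator (hset σ),
      show μ.real {ω | (fun p => U p ω) ∈ B} = _ from (integral_indicator_one (hUm hB)).symm,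
      ← integral_const_mul]
    refine integral_congr_ae ?_
    filter_upwards [ae_mem_Ico hmeas hunif, ae_injective hmeas hunif hindep] with ω hω hω'
    by_cases hb : (fun p => U p ω) ∈ B
    · simp [Set.indicator_apply, hBσ, hb, ← hN _ hω' hω]
    · simp [hBσ, hb]
  have hf : ((Fintype.card ι).factorial : ℝ) ≠ 0 := by positivity
  push_cast
  field_simp
  linarith

/-- The number of points that are at most `x` is binomially distributed. -/
lemma measureReal_card_le_eq (hmeas : ∀ p, Measurable (U p))
    (hunif : ∀ p, pdf.IsUniform (U p) (Set.Ico (0 : ℝ) 1) μ volume) (hindep : iIndepFun U μ)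
    {x : ℝ} (h0 : 0 ≤ x) (h1 : x < 1) (j : ℕ) :
    μ.real {ω | (Finset.univ.filter fun p => U p ω ≤ x).card = j}
      = (Fintype.card ι).choose j * x ^ j * (1 - x) ^ (Fintype.card ι - j) := by
  classical
  have hUm : Measurable fun ω p => U p ω := measurable_pi_lambda _ hmeas
  have hIic : unifMeasure.real (Set.Iic x) = x := by
    rw [measureReal_restrict_apply measurableSet_Iic,
      show Set.Iic x ∩ Set.Ico 0 1 = Set.Icc 0 x by
        ext z; simp only [Set.mem_inter_iff, Set.mem_Iic, Set.mem_Ico, Set.mem_Icc]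
        exact ⟨fun h => ⟨h.2.1, h.1⟩, fun h => ⟨h.2, h.1, h.2.trans_lt h1⟩⟩,
      Real.volume_real_Icc_of_le h0, sub_zero]
  have hIoi : unifMeasure.real (Set.Ioi x) = 1 - x := by
    rw [← Set.compl_Iic, probReal_compl_eq_one_sub measurableSet_Iic, hIic]
  let Q : Finset ι → Set (ι → ℝ) := fun S =>
    Set.univ.pi fun p => if p ∈ S then Set.Iic x else Set.Ioi x
  have hQm : ∀ S, MeasurableSet (Q S) := fun S => MeasurableSet.univ_pi fun p => by
    split_ifs <;> measurability
  have hmem : ∀ S u, u ∈ Q S ↔ Finset.univ.filter (fun p => u p ≤ x) = S := fun S u => by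
    simp only [Q, Set.mem_univ_pi, Finset.ext_iff, Finset.mem_filter, Finset.mem_univ, true_and]
    refine forall_congr' fun p => ?_
    by_cases hp : p ∈ S <;> simp [hp]
  have hQ : ∀ S, μ.real ((fun ω p => U p ω) ⁻¹' Q S)
      = x ^ S.card * (1 - x) ^ (Fintype.card ι - S.card) := fun S => by
    rw [← map_measureReal_apply hUm (hQm S), map_eq_pi hmeas hunif hindep, measureReal_def,
      Measure.pi_pi, ENNReal.toReal_prod]
    have : ∀ p, (unifMeasure (if p ∈ S then Set.Iic x else Set.Ioi x)).toReal
        = if p ∈ S then x else 1 - x := fun p => by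
      split_ifs
      · exact hIic
      · exact hIoi
    simp_rw [this, Finset.prod_ite, Finset.prod_const]
    rw [Finset.filter_mem_eq_inter, Finset.univ_inter, Finset.filter_not,
      Finset.filter_mem_eq_inter, Finset.univ_inter, Finset.card_univ_sdiff]
  have hunion : {ω | (Finset.univ.filter fun p => U p ω ≤ x).card = j}
      = ⋃ S ∈ Finset.univ.powersetCard j, (fun ω p => U p ω) ⁻¹' Q S := by
    ext ω
    simp [hmem, Finset.mem_powersetCard]
  have hdisj : ((Finset.univ.powersetCard j : Finset (Finset ι)) : Set (Finset ι)).PairwiseDisjoint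
      fun S => (fun ω p => U p ω) ⁻¹' Q S := fun S _ T _ hST =>
    Set.disjoint_left.2 fun ω hS hT => hST (((hmem S _).1 hS).symm.trans ((hmem T _).1 hT))
  rw [hunion, measureReal_biUnion_finset hdisj fun S _ => hUm (hQm S),
    Finset.sum_congr rfl fun S hS => (hQ S).trans (by rw [(Finset.mem_powersetCard.1 hS).2]),
    Finset.sum_const, Finset.card_powersetCard, Finset.card_univ, nsmul_eq_mul, mul_assoc]

end Exchangeable

/-! ### The index of the stopping point -/

section Index

variable {n : ℕ}

/-- Under both families the clock visits the same labels. The origin is not one of the points, but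
it lies below all of them in either family, which starts the induction. -/
lemma exists_position_eq {u v : Fin n × Fin 2 → ℝ} (hu : ∀ p, u p ∈ Set.Ico (0 : ℝ) 1)
    (hv : ∀ p, v p ∈ Set.Ico (0 : ℝ) 1) (huv : SameOrder u v) : ∀ (k : ℕ) (h : k < n),
    ∃ p, position u (k + 1) h = u p ∧ position v (k + 1) h = v p := by
  have step : ∀ (k : ℕ) (h : k < n), position u k h.le ∈ Set.Ico (0 : ℝ) 1 →
      position v k h.le ∈ Set.Ico (0 : ℝ) 1 →
      (∀ p, position u k h.le ≤ u p ↔ position v k h.le ≤ v p) →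
      ∃ p, position u (k + 1) h = u p ∧ position v (k + 1) h = v p := by
    intro k h hx hy hxy
    have key : arc (position u k h.le) (u (⟨k, h⟩, 0)) ≤ arc (position u k h.le) (u (⟨k, h⟩, 1)) ↔
        arc (position v k h.le) (v (⟨k, h⟩, 0)) ≤ arc (position v k h.le) (v (⟨k, h⟩, 1)) := by
      rw [arc_le_arc_iff hx (hu _) (hu _), arc_le_arc_iff hy (hv _) (hv _), hxy, hxy, huv]
    simp only [position, firstOf]
    by_cases hc : arc (position v k h.le) (v (⟨k, h⟩, 0)) ≤ arc (position v k h.le) (v (⟨k, h⟩, 1))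
    · exact ⟨(⟨k, h⟩, 0), by rw [if_pos (key.2 hc)], by rw [if_pos hc]⟩
    · exact ⟨(⟨k, h⟩, 1), by rw [if_neg (mt key.1 hc)], by rw [if_neg hc]⟩
  intro k
  induction k with
  | zero =>
    exact fun h => step 0 h (by simp [position]) (by simp [position])
      (fun p => by simp [position, (hu p).1, (hv p).1])
  | succ k ih =>
    intro h
    obtain ⟨p, hp, hp'⟩ := ih (Nat.lt_of_succ_lt h)
    refine step (k + 1) h ?_ ?_ fun q => ?_
    · rw [hp]; exact hu p
    · rw [hp']; exact hv p
    · rw [hp, hp']; exact huv p q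

lemma clockIndex_eq_of_sameOrder (hn : 1 ≤ n) {u v : Fin n × Fin 2 → ℝ}
    (hu : ∀ p, u p ∈ Set.Ico (0 : ℝ) 1) (hv : ∀ p, v p ∈ Set.Ico (0 : ℝ) 1)
    (huv : SameOrder u v) : clockIndex u = clockIndex v := by
  obtain ⟨k, rfl⟩ : ∃ k, n = k + 1 := ⟨n - 1, by omega⟩
  obtain ⟨p, hp, hp'⟩ := exists_position_eq hu hv huv k k.lt_succ_self
  simp only [clockIndex, orderIndex]
  rw [hp, hp']
  simp_rw [huv _ p]

lemma exists_position_eq_point (u : Fin n × Fin 2 → ℝ) (hn : 1 ≤ n) :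
    ∃ p, position u n le_rfl = u p := by
  obtain ⟨k, rfl⟩ : ∃ k, n = k + 1 := ⟨n - 1, by omega⟩
  simp only [position, firstOf]
  split_ifs
  exacts [⟨_, rfl⟩, ⟨_, rfl⟩]

/-- If the stopping point exceeds `x`, it is itself counted by its rank but not among the points at
most `x`, so the inclusion is strict. -/
lemma clockIndex_le_iff (hn : 1 ≤ n) (u : Fin n × Fin 2 → ℝ) (x : ℝ) :
    clockIndex u ≤ orderIndex u x ↔ position u n le_rfl ≤ x := by
  obtain ⟨p, hp⟩ := exists_position_eq_point u hn
  simp only [clockIndex, orderIndex]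
  constructor
  · intro h
    by_contra! hlt
    refine h.not_gt (Finset.card_lt_card (Finset.ssubset_iff_of_subset ?_ |>.2 ⟨p, ?_, ?_⟩))
    · exact Finset.monotone_filter_right _ fun q _ hq => hq.trans hlt.le
    · simp [hp]
    · simpa [← hp] using hlt
  · intro h
    exact Finset.card_le_card (Finset.monotone_filter_right _ fun q _ hq => hq.trans h)

lemma measurable_orderIndex {f : (Fin n × Fin 2 → ℝ) → ℝ} (hf : Measurable f) :
    Measurable fun u => orderIndex u (f u) := by
  simp only [orderIndex, Finset.card_filter]
  exact Finset.measurable_sum _ fun p _ => Measurable.ite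
    (measurableSet_le (measurable_pi_apply p) hf) measurable_const measurable_const

lemma measurable_clockIndex : Measurable (clockIndex (n := n)) :=
  measurable_orderIndex (measurable_position n le_rfl)

variable {Ω : Type*} [MeasurableSpace Ω] {μ : Measure Ω} [IsProbabilityMeasure μ]
  {U : Fin n × Fin 2 → Ω → ℝ}

/-- The distribution function of the position of the clock, expanded in the Bernstein polynomials
with the distribution function of its index as coefficients. -/
theorem exists_measureReal_clockIndex_le (hn : 1 ≤ n) (hmeas : ∀ p, Measurable (U p))
    (hunif : ∀ p, pdf.IsUniform (U p) (Set.Ico (0 : ℝ) 1) μ volume) (hindep : iIndepFun U μ) :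
    ∃ r : ℕ → ℚ, (∀ j, μ.real {ω | clockIndex (fun p => U p ω) ≤ j} = r j) ∧
      ∀ x : ℝ, 0 ≤ x → x < 1 → μ.real {ω | position (fun p => U p ω) n le_rfl ≤ x}
        = ∑ j ∈ Finset.range (2 * n + 1),
          r j * ((2 * n).choose j * x ^ j * (1 - x) ^ (2 * n - j)) := by
  have hcard : Fintype.card (Fin n × Fin 2) = 2 * n := by simp [mul_comm]
  have hUm : Measurable fun ω p => U p ω := measurable_pi_lambda _ hmeas
  have hAm : ∀ j, MeasurableSet {u : Fin n × Fin 2 → ℝ | clockIndex u ≤ j} := fun j =>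
    measurableSet_le measurable_clockIndex measurable_const
  choose r hr using fun j => exists_measureReal_inter_eq (hAm j) (fun u v hu hv huv => by
    simp only [Set.mem_ofPred_eq, clockIndex_eq_of_sameOrder hn hu hv huv]) hmeas hunif hindep
  refine ⟨r, fun j => ?_, fun x h0 h1 => ?_⟩
  -- The whole space is symmetric, so it identifies `r j` as the probability itself.
  · simpa using hr j Set.univ MeasurableSet.univ (by simp)
  let B : ℕ → Set (Fin n × Fin 2 → ℝ) := fun j => {u | orderIndex u x = j}
  have hBm : ∀ j, MeasurableSet (B j) := fun j =>
    measurableSet_eq_fun (measurable_orderIndex measurable_const) measurable_const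
  have hB : ∀ (j) (σ : Equiv.Perm (Fin n × Fin 2)) (u : Fin n × Fin 2 → ℝ),
      u ∘ σ ∈ B j ↔ u ∈ B j := fun j σ u => by
    have : orderIndex (u ∘ σ) x = orderIndex u x :=
      Finset.card_equiv σ fun p => by simp
    simp only [B, Set.mem_ofPred_eq, this]
  -- Partition by the number `j` of points at most `x`: each piece is an order-invariant event
  -- intersected with a symmetric one.
  have hunion : {ω | position (fun p => U p ω) n le_rfl ≤ x}
      = ⋃ j ∈ Finset.range (2 * n + 1),
        (fun ω p => U p ω) ⁻¹' ({u | clockIndex u ≤ j} ∩ B j) := by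
    ext ω
    have hlt : orderIndex (fun p => U p ω) x < 2 * n + 1 :=
      Nat.lt_succ_of_le ((Finset.card_le_univ _).trans hcard.le)
    simp only [Set.mem_ofPred_eq, ← clockIndex_le_iff hn, Set.mem_iUnion, Finset.mem_range, B,
      Set.mem_preimage, Set.mem_inter_iff, exists_prop]
    exact ⟨fun h => ⟨_, hlt, h, rfl⟩, fun ⟨j, _, h, hj⟩ => hj ▸ h⟩
  rw [hunion, measureReal_biUnion_finset (fun i _ j _ hij => Set.disjoint_left.2 fun ω hi hj =>
    hij (hi.2.symm.trans hj.2)) fun j _ => hUm ((hAm j).inter (hBm j))]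
  refine Finset.sum_congr rfl fun j _ => (hr j (B j) (hBm j) (hB j)).trans ?_
  rw [← hcard, ← measureReal_card_le_eq hmeas hunif hindep h0 h1 j]
  rfl

end Index

/-! ### Bernstein sums of the proposed distribution -/

/-- Binomial moment of a binomial variable: `C(N,j) C(j,m) = C(N,m) C(N-m,j-m)`, and the binomial
theorem sums the rest to 1. -/
lemma sum_choose_mul_bernstein {R : Type*} [CommRing R] (N m : ℕ) (x : R) :
    ∑ j ∈ Finset.range (N + 1), (j.choose m : R) * (N.choose j * x ^ j * (1 - x) ^ (N - j))
      = N.choose m * x ^ m := by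
  rcases lt_or_ge N m with h | h
  · rw [Nat.choose_eq_zero_of_lt h, Finset.sum_eq_zero fun j hj => ?_]
    · simp
    · rw [Nat.choose_eq_zero_of_lt (by rw [Finset.mem_range] at hj; omega)]; simp
  · obtain ⟨d, rfl⟩ := Nat.exists_eq_add_of_le h
    have h0 : ∑ j ∈ Finset.range m, (j.choose m : R) *
        ((m + d).choose j * x ^ j * (1 - x) ^ (m + d - j)) = 0 :=
      Finset.sum_eq_zero fun j hj => by
        rw [Nat.choose_eq_zero_of_lt (Finset.mem_range.1 hj)]; simp
    have h1 : ∑ i ∈ Finset.range (d + 1), x ^ i * (1 - x) ^ (d - i) * (d.choose i : R) = 1 := by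
      rw [← add_pow]; simp
    rw [add_assoc, Finset.sum_range_add, h0, zero_add]
    calc _ = ∑ i ∈ Finset.range (d + 1), ((m + d).choose m * x ^ m) *
          (x ^ i * (1 - x) ^ (d - i) * (d.choose i : R)) := by
          refine Finset.sum_congr rfl fun i hi => ?_
          have hi' : i ≤ d := Nat.lt_succ_iff.1 (Finset.mem_range.1 hi)
          have hc := Nat.choose_mul (n := m + d) (k := m + i) (s := m) (by omega)
          rw [Nat.add_sub_cancel_left, Nat.add_sub_cancel_left] at hc
          have hc' : ((m + d).choose (m + i) : R) * (m + i).choose m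
              = (m + d).choose m * d.choose i := by
            rw [← Nat.cast_mul, hc, Nat.cast_mul]
          rw [show m + d - (m + i) = d - i by omega, pow_add]
          linear_combination (x ^ m * x ^ i * (1 - x) ^ (d - i)) * hc'
      _ = _ := by rw [← Finset.mul_sum, h1, mul_one]

lemma sum_range_choose_right (i j : ℕ) :
    ∑ k ∈ Finset.range j, k.choose i = j.choose (i + 1) := by
  induction j with
  | zero => simp
  | succ j ih => rw [Finset.sum_range_succ, ih, Nat.choose_succ_succ, add_comm]

lemma sum_delta (n j : ℕ) : ∑ k ∈ Finset.range j, delta n (k + 1)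
    = 2 ^ (n - 1) / (n * n.factorial) * ∑ i ∈ Finset.range (n + 1),
      (j.choose (i + 1) : ℚ) * (n.choose i : ℚ) / ((2 * n - 1).choose i : ℚ)
        * bernoulli (n - i) := by
  simp only [delta, ← Finset.mul_sum, Nat.add_sub_cancel]
  rw [Finset.sum_comm]
  congr 1
  refine Finset.sum_congr rfl fun i _ => ?_
  rw [← sum_range_choose_right]
  push_cast
  simp only [Finset.sum_mul, Finset.sum_div]

/-- The primitive of the `n`-th Bernoulli polynomial that vanishes at `0`. -/
lemma bernoulli_succ_eval_sub (n : ℕ) (x : ℚ) :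
    ((Polynomial.bernoulli (n + 1)).eval x - (Polynomial.bernoulli (n + 1)).eval 0) / (n + 1)
      = ∑ i ∈ Finset.range (n + 1), (n.choose i : ℚ) * bernoulli (n - i) * x ^ (i + 1) / (i + 1) := by
  simp only [Polynomial.bernoulli_def, Polynomial.eval_finsetSum, Polynomial.eval_monomial]
  rw [Finset.sum_range_succ' _ (n + 1), Finset.sum_range_succ' _ (n + 1)]
  simp only [zero_pow (Nat.succ_ne_zero _), mul_zero, Finset.sum_const_zero, zero_add, pow_zero,
    add_sub_cancel_right, Finset.sum_div]
  refine Finset.sum_congr rfl fun i _ => ?_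
  have h : ((n : ℚ) + 1) * n.choose i = (n + 1).choose (i + 1) * (i + 1) := by
    exact_mod_cast Nat.add_one_mul_choose_eq n i
  rw [Nat.add_sub_add_right]
  have h1 : (n : ℚ) + 1 ≠ 0 := by positivity
  have h2 : (i : ℚ) + 1 ≠ 0 := by positivity
  field_simp
  linear_combination (-(bernoulli (n - i) * x ^ (i + 1))) * h

/-- The Bernstein sum turns `C(j,i+1)` into `C(2n,i+1) x^(i+1)`. Since `2n C(2n-1,i) = (i+1)
C(2n,i+1)`, the denominators in `delta` reduce this to the terms `x^(i+1)/(i+1)` of the Bernoulli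
primitive. -/
lemma sum_bernstein_delta {n : ℕ} (hn : 1 ≤ n) (x : ℚ) :
    ∑ j ∈ Finset.range (2 * n + 1), ((j : ℚ) / (2 * n) - ∑ k ∈ Finset.range j, delta n (k + 1))
        * ((2 * n).choose j * x ^ j * (1 - x) ^ (2 * n - j))
      = x - 2 ^ n / n.factorial * (((Polynomial.bernoulli (n + 1)).eval x
        - (Polynomial.bernoulli (n + 1)).eval 0) / (n + 1)) := by
  have hn0 : (n : ℚ) ≠ 0 := by positivity
  have h1 := sum_choose_mul_bernstein (2 * n) 1 x
  simp only [Nat.choose_one_right, pow_one] at h1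
  simp only [sub_mul, Finset.sum_sub_distrib]
  congr 1
  · simp only [div_mul_eq_mul_div, ← Finset.sum_div, h1]
    push_cast
    field_simp
  · simp only [sum_delta, bernoulli_succ_eval_sub, Finset.mul_sum, Finset.sum_mul]
    rw [Finset.sum_comm]
    refine Finset.sum_congr rfl fun i hi => ?_
    have hi' : i ≤ n := Nat.lt_succ_iff.1 (Finset.mem_range.1 hi)
    have hc0 : ((2 * n - 1).choose i : ℚ) ≠ 0 :=
      Nat.cast_ne_zero.2 (Nat.choose_pos (by omega)).ne'
    have hc : (2 * n : ℚ) * (2 * n - 1).choose i = (2 * n).choose (i + 1) * (i + 1) := by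
      have := Nat.add_one_mul_choose_eq (2 * n - 1) i
      rw [show 2 * n - 1 + 1 = 2 * n by omega] at this
      exact_mod_cast this
    have hp : (2 : ℚ) ^ n = 2 * 2 ^ (n - 1) := by
      rw [← pow_succ', Nat.sub_add_cancel hn]
    have h2 : (i : ℚ) + 1 ≠ 0 := by positivity
    have hf : (n.factorial : ℚ) ≠ 0 := by positivity
    calc _ = 2 ^ (n - 1) / (n * n.factorial) * (n.choose i : ℚ) / ((2 * n - 1).choose i : ℚ)
          * bernoulli (n - i) * ∑ j ∈ Finset.range (2 * n + 1),
            (j.choose (i + 1) : ℚ) * ((2 * n).choose j * x ^ j * (1 - x) ^ (2 * n - j)) := by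
          rw [Finset.mul_sum]
          exact Finset.sum_congr rfl fun j _ => by ring
      _ = _ := by
          rw [sum_choose_mul_bernstein, hp]
          field_simp
          linear_combination (-((n.choose i : ℚ) * bernoulli (n - i) * x ^ (i + 1))) * hc

/-- The difference is a polynomial with infinitely many rational roots, hence zero, and the
Bernstein polynomials are linearly independent. -/
lemma eq_of_sum_bernstein_eq {N : ℕ} {r s : ℕ → ℚ} (h : ∀ x : ℚ, 0 ≤ x → x < 1 →
      ∑ j ∈ Finset.range (N + 1), r j * (N.choose j * x ^ j * (1 - x) ^ (N - j))
        = ∑ j ∈ Finset.range (N + 1), s j * (N.choose j * x ^ j * (1 - x) ^ (N - j)))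
    {j : ℕ} (hj : j ≤ N) : r j = s j := by
  have hP : ∑ i : Fin (N + 1), (r i - s i) • bernsteinPolynomial ℚ N i = 0 := by
    refine Polynomial.eq_zero_of_infinite_isRoot _
      ((Set.Ico_infinite (zero_lt_one (α := ℚ))).mono fun x hx => ?_)
    have hx' := h x hx.1 hx.2
    rw [← sub_eq_zero, ← Finset.sum_sub_distrib, Finset.sum_range] at hx'
    simp only [← sub_mul] at hx'
    simpa [Polynomial.IsRoot, Polynomial.eval_finsetSum, bernsteinPolynomial] using hx'
  exact sub_eq_zero.1 (Fintype.linearIndependent_iff.1 (bernsteinPolynomial.linearIndependent N)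
    (fun i => r i - s i) hP ⟨j, Nat.lt_succ_of_le hj⟩)

lemma bernoulliFun_ratCast (k : ℕ) (x : ℚ) :
    bernoulliFun k (x : ℝ) = ((Polynomial.bernoulli k).eval x : ℚ) := by
  rw [bernoulliFun, ← eq_ratCast (algebraMap ℚ ℝ) x, Polynomial.eval_map_apply, eq_ratCast]

/-! ### Identification of the law of the index -/

theorem measureReal_clockIndex_le {n : ℕ} (hn : 1 ≤ n) {Ω : Type*} [MeasurableSpace Ω]
    {μ : Measure Ω} [IsProbabilityMeasure μ] {U : Fin n × Fin 2 → Ω → ℝ}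
    (hmeas : ∀ p, Measurable (U p))
    (hunif : ∀ p, pdf.IsUniform (U p) (Set.Ico (0 : ℝ) 1) μ volume)
    (hindep : iIndepFun U μ) {j : ℕ} (hj : j ≤ 2 * n) :
    μ.real {ω | clockIndex (fun p => U p ω) ≤ j}
      = ((j / (2 * n) - ∑ k ∈ Finset.range j, delta n (k + 1) : ℚ) : ℝ) := by
  obtain ⟨r, hr, hx⟩ := exists_measureReal_clockIndex_le hn hmeas hunif hindep
  rw [hr j]
  congr 1
  -- The coefficients `r` are rational, so comparison at rational `x` suffices.
  refine eq_of_sum_bernstein_eq (r := r)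
    (s := fun j => j / (2 * n) - ∑ k ∈ Finset.range j, delta n (k + 1)) (fun x h0 h1 => ?_) hj
  rw [sum_bernstein_delta hn x]
  have h0' : (0 : ℝ) ≤ x := by exact_mod_cast h0
  have h1' : (x : ℝ) < 1 := by exact_mod_cast h1
  have key := (hx x h0' h1').symm.trans (measureReal_position_le hn hmeas hunif hindep h0' h1')
  have hz := bernoulliFun_ratCast (n + 1) 0
  rw [Rat.cast_zero] at hz
  rw [bernoulliFun_ratCast, hz] at key
  apply Rat.cast_injective (α := ℝ)
  push_cast at key ⊢
  exact key

/-- `k ↦ δ_{k:2n}` is the restriction of a polynomial of degree at most `n`. -/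
lemma exists_polynomial_delta (n : ℕ) : ∃ q : Polynomial ℚ, q.natDegree ≤ n ∧
    ∀ k : ℕ, 1 ≤ k → delta n k = q.eval (k : ℚ) := by
  -- `C(k-1,i)` is the falling factorial of `k - 1` divided by `i!`, a polynomial of degree `i` in
  -- `k`; `1 ≤ k` makes the natural subtraction exact.
  refine ⟨Polynomial.C (2 ^ (n - 1) / (n * n.factorial) : ℚ) * ∑ i ∈ Finset.range (n + 1),
    Polynomial.C ((n.choose i : ℚ) / ((2 * n - 1).choose i : ℚ) * bernoulli (n - i)
      / i.factorial) * (descPochhammer ℚ i).comp (Polynomial.X - Polynomial.C 1), ?_, ?_⟩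
  · refine (Polynomial.natDegree_C_mul_le _ _).trans
      (Polynomial.natDegree_sum_le_of_forall_le _ _ fun i hi => ?_)
    refine (Polynomial.natDegree_C_mul_le _ _).trans ?_
    rw [Polynomial.natDegree_comp, Polynomial.natDegree_X_sub_C, mul_one, descPochhammer_natDegree]
    exact Nat.lt_succ_iff.1 (Finset.mem_range.1 hi)
  · intro k hk
    rw [delta, Polynomial.eval_mul, Polynomial.eval_C, Polynomial.eval_finsetSum]
    congr 1
    refine Finset.sum_congr rfl fun i _ => ?_
    have hk' : (k : ℚ) - 1 = ((k - 1 : ℕ) : ℚ) := by rw [Nat.cast_sub hk, Nat.cast_one]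
    have hf : (i.factorial : ℚ) ≠ 0 := by positivity
    rw [Polynomial.eval_mul, Polynomial.eval_C, Polynomial.eval_comp, Polynomial.eval_sub,
      Polynomial.eval_X, Polynomial.eval_C, hk', descPochhammer_eval_eq_descFactorial,
      Nat.descFactorial_eq_factorial_mul_choose]
    push_cast
    field_simp

end BernoulliClock

end

theorem mainTheorem7 (n : ℕ) (hn : 1 ≤ n)
    {Ω : Type*} [MeasurableSpace Ω] (μ : Measure Ω) [IsProbabilityMeasure μ]
    (U : Fin n × Fin 2 → Ω → ℝ)
    (hmeas : ∀ p, Measurable (U p))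
    (hunif : ∀ p, pdf.IsUniform (U p) (Set.Ico (0 : ℝ) 1) μ volume)
    (hindep : iIndepFun U μ) :
    (∀ k : ℕ, 1 ≤ k → k ≤ 2 * n →
      μ.real {ω | BernoulliClock.clockIndex (fun p => U p ω) = k}
        = 1 / (2 * (n : ℝ)) - (BernoulliClock.delta n k : ℝ)) ∧
    ∃ q : Polynomial ℚ, q.natDegree ≤ n ∧
      ∀ k : ℕ, 1 ≤ k → k ≤ 2 * n → BernoulliClock.delta n k = q.eval (k : ℚ) := by
  refine ⟨fun k hk hk2 => ?_, ?_⟩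
  · obtain ⟨j, rfl⟩ : ∃ j, k = j + 1 := ⟨k - 1, by omega⟩
    have hI : Measurable fun ω => BernoulliClock.clockIndex fun p => U p ω :=
      BernoulliClock.measurable_clockIndex.comp (measurable_pi_lambda _ hmeas)
    have hdiff : {ω | BernoulliClock.clockIndex (fun p => U p ω) = j + 1}
        = {ω | BernoulliClock.clockIndex (fun p => U p ω) ≤ j + 1}
          \ {ω | BernoulliClock.clockIndex (fun p => U p ω) ≤ j} := by
      ext ω; simp only [Set.mem_ofPred_eq, Set.mem_sdiff]; omega
    have hsub : {ω | BernoulliClock.clockIndex (fun p => U p ω) ≤ j}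
        ⊆ {ω | BernoulliClock.clockIndex (fun p => U p ω) ≤ j + 1} :=
      fun ω hω => Nat.le_succ_of_le hω
    rw [hdiff, measureReal_sdiff hsub (measurableSet_le hI measurable_const),
      BernoulliClock.measureReal_clockIndex_le hn hmeas hunif hindep hk2,
      BernoulliClock.measureReal_clockIndex_le hn hmeas hunif hindep (Nat.le_of_succ_le hk2),
      Finset.sum_range_succ]
    push_cast
    ring
  · obtain ⟨q, hq, hq'⟩ := BernoulliClock.exists_polynomial_delta n
    exact ⟨q, hq, fun k hk _ => hq' k hk⟩
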